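/- All graphs are finite and simple. A graph is \emph{quintic} if it is $5$-regular. A \emph{$1$-factorisation} of a graph is a partition of its edge set into perfect matchings, and a graph is \emph{perfectly hamiltonian} if it has a $1$-factorisation in which the union of any two distinct perfect matchings is a hamiltonian cycle. \textbf{Theorem.} For every $n$ let $f(n)$ be the number of isomorphism classes of planar quintic perfectly hamiltonian graphs on $n$ vertices. Then $f$ grows at least exponentially on the even integers: there are a real number $c>1$ and an integer $N$ such that $f(n)\ge c^{\,n}$ for every even $n\ge N$. -/

import Mathlib

/-- A graph is planar if it can be drawn in the plane: vertices are distinct points, every edge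
is an arc (the image of an injective path) joining its two ends, an arc contains no vertex other
than its ends, and two distinct arcs meet only in common ends. -/
def IsPlanarGraph {V : Type*} (G : SimpleGraph V) : Prop :=
  ∃ (pos : V → ℝ × ℝ) (arc : Sym2 V → Set (ℝ × ℝ)),
    Function.Injective pos ∧
    (∀ u v, G.Adj u v →
      ∃ γ : Path (pos u) (pos v), Function.Injective γ ∧ Set.range γ = arc s(u, v)) ∧
    (∀ e ∈ G.edgeSet, ∀ w, pos w ∈ arc e → w ∈ e) ∧
    (∀ e ∈ G.edgeSet, ∀ f ∈ G.edgeSet, e ≠ f →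
      ∀ x ∈ arc e ∩ arc f, ∃ w, w ∈ e ∧ w ∈ f ∧ x = pos w)

/-- A set `F` of subgraphs of `G` is a 1-factorisation of `G`: its members are 1-factors
(perfect matchings) of `G`, and every edge of `G` lies in exactly one of them. -/
def IsOneFactorisation {V : Type*} (G : SimpleGraph V) (F : Set G.Subgraph) : Prop :=
  (∀ M ∈ F, M.IsPerfectMatching) ∧ ∀ e ∈ G.edgeSet, ∃! M, M ∈ F ∧ e ∈ M.edgeSet

/-- Two 1-factors form a perfect pair if their union is (the edge set of) a hamiltonian cycle. -/
def IsPerfectPair {V : Type*} [DecidableEq V] {G : SimpleGraph V} (M N : G.Subgraph) : Prop :=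
  ∃ (v : V) (p : G.Walk v v), p.IsHamiltonianCycle ∧
    ∀ e, e ∈ p.edges ↔ e ∈ M.edgeSet ∨ e ∈ N.edgeSet

/-- A graph is perfectly hamiltonian if it has a perfect 1-factorisation, that is, one in which
any two distinct 1-factors form a perfect pair. -/
def IsPerfectlyHamiltonian {V : Type*} [DecidableEq V] (G : SimpleGraph V) : Prop :=
  ∃ F : Set G.Subgraph, IsOneFactorisation G F ∧
    ∀ M ∈ F, ∀ N ∈ F, M ≠ N → IsPerfectPair M N

open Classical in
/-- A graph is quintic if it is 5-regular. -/
def IsQuintic {V : Type*} [Fintype V] (G : SimpleGraph V) : Prop :=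
  G.IsRegularOfDegree 5

/-- The isomorphism relation on the graphs with vertex set `Fin n`. -/
def graphIsoSetoid (n : ℕ) : Setoid (SimpleGraph (Fin n)) where
  r G H := Nonempty (G ≃g H)
  iseqv :=
    { refl := fun _ => ⟨SimpleGraph.Iso.refl⟩
      symm := fun ⟨f⟩ => ⟨f.symm⟩
      trans := fun ⟨f⟩ ⟨g⟩ => ⟨g.comp f⟩ }

/-- The number of planar quintic perfectly hamiltonian graphs of order `n`, up to isomorphism. -/
noncomputable def numPlanarQuinticPerfectlyHamiltonian (n : ℕ) : ℕ :=
  Set.ncard {C : Quotient (graphIsoSetoid n) | ∃ G : SimpleGraph (Fin n),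
    Quotient.mk (graphIsoSetoid n) G = C ∧
      IsPlanarGraph G ∧ IsQuintic G ∧ IsPerfectlyHamiltonian G}

/-! The graphs are chains of plane blocks, each with five ports on either side, closed at the two
ends by a single source and a single sink. Consecutive blocks are joined by five edges, one of each
colour. Between the ends stands one fixed block and then an arbitrary word in two letters, the short
block (26 vertices) and the long block (28 vertices).

Hamiltonicity: two colours form a 2-regular graph, so their union is a hamiltonian cycle once it is
connected. In every block except the source, the two-coloured path through any vertex leaves on the
left in at least one of its two directions (`Block.escapes`, a finite check). Going left repeatedly,
every vertex reaches the source.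

Planarity: a straight-line drawing puts each block in its own vertical strip of width 400. Two edges
either have ends in a common block, where a finite check keeps them apart, or lie in disjoint ranges
of strips.

Counting: the distances from the source determine the word. Each block shifts distances by two, so
their generating polynomial is a sum of `X ^ (2 * k)` times block polynomials. It determines the
product of the nonzero difference (long minus short) with a 0/1 polynomial recording the word, and
the difference cancels in `ℤ[X]` (`BlockChain.word_eq_of_iso`). Hence distinct words give
non-isomorphic graphs rooted at the source. A graph of order `n` has at most `n` roots, so `2 ^ p`
words of equal order give at least `2 ^ p / n` classes. Writing each letter with its negation
equalises the orders, and a bounded tail of short blocks reaches every large even `n`. -/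

/-! ### Edge-coloured quintic graphs and perfect 1-factorisations. -/

/-- Five fixed-point-free involutions without common values: a proper `5`-edge-colouring of a
quintic graph, given by the neighbour of each vertex along each colour. -/
structure ColouredNeighbours (V : Type*) where
  nb : Fin 5 → V → V
  nb_nb : ∀ c v, nb c (nb c v) = v
  nb_ne : ∀ c v, nb c v ≠ v
  nb_injective : ∀ v, Function.Injective fun c => nb c v

namespace ColouredNeighbours

variable {V W : Type*} (N : ColouredNeighbours V)

/-- The underlying quintic graph. -/
def graph : SimpleGraph V where
  Adj u v := ∃ c, N.nb c u = v
  symm := ⟨by rintro u v ⟨c, rfl⟩; exact ⟨c, N.nb_nb c u⟩⟩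
  loopless := ⟨by rintro u ⟨c, hc⟩; exact N.nb_ne c u hc⟩

/-- The subgraph of the edges of two colours. -/
def pairGraph (c d : Fin 5) : SimpleGraph V where
  Adj u v := N.nb c u = v ∨ N.nb d u = v
  symm := ⟨by
    rintro u v (rfl | rfl)
    · exact Or.inl (N.nb_nb c u)
    · exact Or.inr (N.nb_nb d u)⟩
  loopless := ⟨by
    rintro u (h | h)
    · exact N.nb_ne c u h
    · exact N.nb_ne d u h⟩

theorem pairGraph_le (c d : Fin 5) : N.pairGraph c d ≤ N.graph := by
  rintro u v (h | h)
  · exact ⟨c, h⟩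
  · exact ⟨d, h⟩

/-- The perfect matching formed by the edges of one colour. -/
def factor (c : Fin 5) : N.graph.Subgraph where
  verts := Set.univ
  Adj u v := N.nb c u = v
  adj_sub h := ⟨c, h⟩
  edge_vert _ := trivial
  symm := ⟨by rintro u v rfl; exact N.nb_nb c u⟩

theorem factor_isPerfectMatching (c : Fin 5) : (N.factor c).IsPerfectMatching :=
  SimpleGraph.Subgraph.isPerfectMatching_iff.2 fun v =>
    ⟨N.nb c v, rfl, fun _ h => Eq.symm h⟩

theorem isOneFactorisation : IsOneFactorisation N.graph (Set.range N.factor) := by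
  refine ⟨?_, ?_⟩
  · rintro _ ⟨c, rfl⟩
    exact N.factor_isPerfectMatching c
  · rintro ⟨u, v⟩ ⟨c, hc⟩
    refine ⟨N.factor c, ⟨⟨c, rfl⟩, hc⟩, ?_⟩
    rintro _ ⟨⟨d, rfl⟩, hd⟩
    have hd : N.nb d u = v := hd
    rw [N.nb_injective u (hd.trans hc.symm : N.nb d u = N.nb c u)]

theorem neighborSet_graph (v : V) : N.graph.neighborSet v = Set.range fun c => N.nb c v := by
  ext w
  rfl

theorem isQuintic [Fintype V] : IsQuintic N.graph := by
  classical
  intro v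
  rw [← SimpleGraph.card_neighborSet_eq_degree, ← Nat.card_eq_fintype_card, N.neighborSet_graph,
    Nat.card_range_of_injective (N.nb_injective v), Nat.card_eq_fintype_card, Fintype.card_fin]

theorem pairGraph_isCycles {c d : Fin 5} (h : c ≠ d) : (N.pairGraph c d).IsCycles := by
  intro v _
  have : (N.pairGraph c d).neighborSet v = {N.nb c v, N.nb d v} := by
    ext w
    simp [pairGraph, eq_comm]
  rw [this, Set.ncard_pair fun e => h (N.nb_injective v e)]

/-- The union is 2-regular, so a component is traversed by a cycle; by connectedness this cycle is
hamiltonian and uses every edge of the two colours. -/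
theorem isPerfectPair [Finite V] [DecidableEq V] [Nonempty V] {c d : Fin 5} (h : c ≠ d)
    (hc : (N.pairGraph c d).Preconnected) : IsPerfectPair (N.factor c) (N.factor d) := by
  classical
  have := Fintype.ofFinite V
  obtain ⟨v⟩ := ‹Nonempty V›
  obtain ⟨p, hp, hv⟩ :=
    (N.pairGraph_isCycles h).exists_cycle_toSubgraph_verts_eq_connectedComponentSupp
      (c := (N.pairGraph c d).connectedComponentMk v) (v := v) rfl ⟨N.nb c v, Or.inl rfl⟩
  have hall : ∀ w, w ∈ p.toSubgraph.verts := by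
    intro w
    rw [hv]
    exact SimpleGraph.ConnectedComponent.sound (hc w v)
  refine ⟨v, p.mapLe (N.pairGraph_le c d), ?_, ?_⟩
  · rw [SimpleGraph.Walk.isHamiltonianCycle_iff_isCycle_and_support_count_tail_eq_one]
    refine ⟨(SimpleGraph.Walk.isCycle_mapLe _).2 hp, fun a => ?_⟩
    rw [SimpleGraph.Walk.support_mapLe_eq_support]
    refine List.count_eq_one_of_mem hp.support_nodup ?_
    have ha := (SimpleGraph.Walk.mem_verts_toSubgraph p).1 (hall a)
    rcases eq_or_ne a v with rfl | hne
    · exact SimpleGraph.Walk.end_mem_tail_support hp.not_nil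
    · rw [SimpleGraph.Walk.mem_support_iff] at ha
      exact ha.resolve_left hne
  · rintro ⟨a, b⟩
    rw [SimpleGraph.Walk.edges_mapLe_eq_edges, ← SimpleGraph.Walk.mem_edges_toSubgraph]
    exact hp.adj_toSubgraph_iff_of_isCycles (N.pairGraph_isCycles h) (hall a) b

theorem isPerfectlyHamiltonian [Finite V] [DecidableEq V] [Nonempty V]
    (hc : ∀ c d, c ≠ d → (N.pairGraph c d).Preconnected) : IsPerfectlyHamiltonian N.graph := by
  refine ⟨_, N.isOneFactorisation, ?_⟩
  rintro _ ⟨c, rfl⟩ _ ⟨d, rfl⟩ h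
  have hcd : c ≠ d := fun e => h (by rw [e])
  exact N.isPerfectPair hcd (hc c d hcd)

/-- Transport along a bijection of the vertex sets. -/
def congr (e : V ≃ W) : ColouredNeighbours W where
  nb c w := e (N.nb c (e.symm w))
  nb_nb c w := by simp [N.nb_nb]
  nb_ne c w h := N.nb_ne c (e.symm w) (by rw [Equiv.eq_symm_apply]; exact h)
  nb_injective w c d h := N.nb_injective (e.symm w) (e.injective h)

/-- Transport gives an isomorphic graph. -/
def congrIso (e : V ≃ W) : N.graph ≃g (N.congr e).graph where
  toEquiv := e
  map_rel_iff' := by simp [graph, congr]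

theorem pairGraph_congr_preconnected (e : V ≃ W) {c d : Fin 5}
    (h : (N.pairGraph c d).Preconnected) : ((N.congr e).pairGraph c d).Preconnected := by
  let i : N.pairGraph c d ≃g (N.congr e).pairGraph c d :=
    { toEquiv := e
      map_rel_iff' := by simp [pairGraph, congr] }
  exact i.preconnected_iff.1 h

end ColouredNeighbours

/-! ### Straight-line drawings and planarity. -/

/-- Twice the signed area of a triangle. -/
def orient {R : Type*} [CommRing R] (p q r : R × R) : R :=
  (q.1 - p.1) * (r.2 - p.2) - (q.2 - p.2) * (r.1 - p.1)

/-- A criterion for two segments to be disjoint: one of them lies to the left of the other, or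
strictly on one side of the line through the other. -/
def SegmentsApart {R : Type*} [CommRing R] [LinearOrder R] (p q r s : R × R) : Prop :=
  (max p.1 q.1 < min r.1 s.1 ∨ max r.1 s.1 < min p.1 q.1) ∨
    0 < orient p q r * orient p q s ∨ 0 < orient r s p * orient r s q

theorem orient_combo {p q r s x : ℝ × ℝ} {a b : ℝ} (hab : a + b = 1) (hx : a • r + b • s = x) :
    orient p q x = a * orient p q r + b * orient p q s := by
  subst hx
  obtain rfl : b = 1 - a := by linarith
  simp only [orient, Prod.fst_add, Prod.snd_add, Prod.smul_fst, Prod.smul_snd, smul_eq_mul]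
  ring

theorem orient_eq_zero_of_mem_segment {p q x : ℝ × ℝ} (hx : x ∈ segment ℝ p q) :
    orient p q x = 0 := by
  obtain ⟨a, b, -, -, hab, hx⟩ := hx
  rw [orient_combo hab hx]
  simp only [orient]
  ring

theorem fst_le_of_mem_segment {p q x : ℝ × ℝ} (hx : x ∈ segment ℝ p q) :
    min p.1 q.1 ≤ x.1 ∧ x.1 ≤ max p.1 q.1 := by
  obtain ⟨a, b, ha, hb, hab, rfl⟩ := hx
  have h1 := mul_le_mul_of_nonneg_left (min_le_left p.1 q.1) ha
  have h2 := mul_le_mul_of_nonneg_left (min_le_right p.1 q.1) hb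
  have h3 := mul_le_mul_of_nonneg_left (le_max_left p.1 q.1) ha
  have h4 := mul_le_mul_of_nonneg_left (le_max_right p.1 q.1) hb
  have e1 : (a + b) * min p.1 q.1 = min p.1 q.1 := by rw [hab, one_mul]
  have e2 : (a + b) * max p.1 q.1 = max p.1 q.1 := by rw [hab, one_mul]
  simp only [Prod.fst_add, Prod.smul_fst, smul_eq_mul]
  constructor <;> nlinarith

theorem not_mem_segment_of_orient_mul_pos {p q r s x : ℝ × ℝ}
    (h : 0 < orient p q r * orient p q s) (hx : x ∈ segment ℝ p q) (hx' : x ∈ segment ℝ r s) :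
    False := by
  have h0 := orient_eq_zero_of_mem_segment hx
  obtain ⟨a, b, ha, hb, hab, hx'⟩ := hx'
  rw [orient_combo hab hx'] at h0
  rcases pos_and_pos_or_neg_and_neg_of_mul_pos h with ⟨h1, h2⟩ | ⟨h1, h2⟩
  · rcases eq_or_lt_of_le ha with rfl | ha
    · have : b = 1 := by linarith
      subst this
      linarith
    · nlinarith [mul_pos ha h1, mul_nonneg hb h2.le]
  · rcases eq_or_lt_of_le ha with rfl | ha
    · have : b = 1 := by linarith
      subst this
      linarith
    · nlinarith [mul_pos ha (neg_pos.2 h1), mul_nonneg hb (neg_pos.2 h2).le]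

theorem SegmentsApart.disjoint {p q r s : ℝ × ℝ} (h : SegmentsApart p q r s) :
    Disjoint (segment ℝ p q) (segment ℝ r s) := by
  rw [Set.disjoint_left]
  intro x hx hx'
  have h1 := fst_le_of_mem_segment hx
  have h2 := fst_le_of_mem_segment hx'
  rcases h with (h | h) | h | h
  · linarith
  · linarith
  · exact not_mem_segment_of_orient_mul_pos h hx hx'
  · exact not_mem_segment_of_orient_mul_pos h hx' hx

/-- The area form is affine in its third argument, vanishes along the line `p q`, and is nonzero at
`s`; so it vanishes on the segment from `p` to `s` only at `p`. -/
theorem eq_of_mem_segment_of_orient_ne_zero {p q s x : ℝ × ℝ} (h : orient p q s ≠ 0)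
    (hx : x ∈ segment ℝ p q) (hx' : x ∈ segment ℝ p s) : x = p := by
  have h0 := orient_eq_zero_of_mem_segment hx
  obtain ⟨a, b, ha, hb, hab, hx'⟩ := hx'
  rw [orient_combo hab hx'] at h0
  have hp : orient p q p = 0 := by simp [orient]
  have hb0 : b = 0 := by
    rw [hp, mul_zero, zero_add] at h0
    exact (mul_eq_zero.1 h0).resolve_right h
  obtain rfl : a = 1 := by linarith
  simpa [hb0] using hx'.symm

/-- The straight segment between the images of the ends of an unordered pair. -/
def straightArc {V : Type*} (pos : V → ℝ × ℝ) : Sym2 V → Set (ℝ × ℝ) :=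
  Sym2.lift ⟨fun u v => segment ℝ (pos u) (pos v), fun _ _ => segment_symm ℝ _ _⟩

theorem exists_path_range_eq_segment {p q : ℝ × ℝ} (h : p ≠ q) :
    ∃ γ : Path p q, Function.Injective γ ∧ Set.range γ = segment ℝ p q := by
  refine ⟨⟨⟨fun t => AffineMap.lineMap p q (t : ℝ), by fun_prop⟩, by simp, by simp⟩, ?_, ?_⟩
  · intro s t hst
    exact Subtype.ext (AffineMap.lineMap_injective ℝ h hst)
  · rw [segment_eq_image_lineMap]
    ext x
    simp [Set.mem_image, unitInterval]

theorem isPlanarGraph_of_straight {V : Type*} {G : SimpleGraph V} (pos : V → ℝ × ℝ)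
    (hpos : Function.Injective pos) (hdeg : ∀ v, ∃ w, G.Adj v w)
    (h1 : ∀ u v w, G.Adj u v → G.Adj u w → v ≠ w → orient (pos u) (pos v) (pos w) ≠ 0)
    (h2 : ∀ a b c d, G.Adj a b → G.Adj c d → a ≠ c → a ≠ d → b ≠ c → b ≠ d →
      SegmentsApart (pos a) (pos b) (pos c) (pos d)) : IsPlanarGraph G := by
  have key : ∀ e ∈ G.edgeSet, ∀ f ∈ G.edgeSet, e ≠ f →
      ∀ x ∈ straightArc pos e ∩ straightArc pos f, ∃ w, w ∈ e ∧ w ∈ f ∧ x = pos w := by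
    rintro ⟨a, b⟩ he ⟨c, d⟩ hf hef x ⟨hx, hx'⟩
    change G.Adj a b at he
    change G.Adj c d at hf
    change x ∈ segment ℝ (pos a) (pos b) at hx
    change x ∈ segment ℝ (pos c) (pos d) at hx'
    change s(a, b) ≠ s(c, d) at hef
    change ∃ w, w ∈ s(a, b) ∧ w ∈ s(c, d) ∧ x = pos w
    by_cases hac : a = c
    · subst hac
      have hbd : b ≠ d := fun h => hef (by rw [h])
      exact ⟨a, by simp, by simp, eq_of_mem_segment_of_orient_ne_zero (h1 a b d he hf hbd) hx hx'⟩
    by_cases had : a = d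
    · subst had
      have hbc : b ≠ c := fun h => hef (by rw [h, Sym2.eq_swap])
      rw [segment_symm] at hx'
      exact ⟨a, by simp, by simp,
        eq_of_mem_segment_of_orient_ne_zero (h1 a b c he hf.symm hbc) hx hx'⟩
    by_cases hbc : b = c
    · subst hbc
      rw [segment_symm] at hx
      exact ⟨b, by simp, by simp,
        eq_of_mem_segment_of_orient_ne_zero (h1 b a d he.symm hf had) hx hx'⟩
    by_cases hbd : b = d
    · subst hbd
      rw [segment_symm] at hx hx'
      exact ⟨b, by simp, by simp,
        eq_of_mem_segment_of_orient_ne_zero (h1 b a c he.symm hf.symm hac) hx hx'⟩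
    exact (Set.disjoint_left.1 (h2 a b c d he hf hac had hbc hbd).disjoint hx hx').elim
  refine ⟨pos, straightArc pos, hpos, ?_, ?_, key⟩
  · intro u v huv
    exact exists_path_range_eq_segment (hpos.ne huv.ne)
  · intro e he w hw
    by_contra hwe
    -- A vertex on a foreign edge would be a point shared by that edge and an edge at the vertex,
    -- which reduces this condition to `key`.
    obtain ⟨z, hz⟩ := hdeg w
    have hne : e ≠ s(w, z) := by
      rintro rfl
      simp at hwe
    obtain ⟨y, hy, -, hyw⟩ := key e he s(w, z) hz hne (pos w) ⟨hw, left_mem_segment ℝ _ _⟩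
    exact hwe (hpos hyw ▸ hy)

/-! ### The blocks: tables, ports and finite checks. -/

/-- The pieces from which the graphs are assembled. The pieces `first`, `short` and `long` are
plane graphs with five ports on each side, numbered by the colours; `first` is a copy of `short`.
The pieces `source` and `sink` are single vertices which close the chain. -/
inductive Block
  | source
  | first
  | short
  | long
  | sink
  deriving DecidableEq

/-- Where an edge leads: to a vertex of the same block, or to a port of an adjacent block. -/
inductive Step
  | inner (j : ℕ)
  | left
  | right
  deriving DecidableEq

/-- The neighbours in a short block by vertex and colour; the entry of a port in its own colour
is void. -/
def shortTable : List (List ℕ) :=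
  [[0, 12, 5, 19, 15], [10, 0, 12, 2, 11], [13, 10, 0, 1, 3], [4, 13, 17, 0, 2], [3, 9, 20, 17,
   0], [0, 19, 0, 6, 21], [23, 0, 21, 5, 7], [8, 23, 0, 25, 6], [7, 24, 9, 0, 25], [20, 4, 8,
   24, 0], [1, 2, 13, 11, 16], [12, 14, 16, 10, 1], [11, 0, 1, 15, 14], [2, 3, 10, 23, 17], [15,
   11, 18, 16, 12], [14, 18, 19, 12, 0], [18, 21, 11, 14, 10], [22, 20, 3, 4, 13], [16, 15, 14,
   21, 19], [21, 5, 15, 0, 18], [9, 17, 4, 22, 24], [19, 16, 6, 18, 5], [17, 25, 24, 20, 23],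
   [6, 7, 25, 13, 22], [25, 8, 22, 9, 20], [24, 22, 23, 7, 8]]

/-- The neighbours in a long block by vertex and colour; the entry of a port in its own colour
is void. -/
def longTable : List (List ℕ) :=
  [[0, 12, 5, 21, 1], [10, 0, 12, 2, 0], [3, 10, 0, 1, 11], [2, 4, 16, 0, 14], [9, 3, 20, 16,
   0], [0, 21, 0, 25, 6], [27, 0, 25, 7, 5], [8, 27, 0, 6, 26], [7, 26, 9, 0, 24], [4, 24, 8,
   20, 0], [1, 2, 11, 12, 13], [15, 14, 10, 13, 2], [13, 0, 1, 10, 17], [12, 15, 17, 11, 10],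
   [16, 11, 15, 18, 3], [11, 13, 14, 17, 18], [14, 18, 3, 4, 20], [18, 19, 13, 15, 12], [17, 16,
   19, 14, 15], [23, 17, 18, 22, 21], [24, 22, 4, 9, 16], [25, 5, 23, 0, 19], [26, 20, 24, 19,
   23], [19, 25, 21, 27, 22], [20, 9, 22, 26, 8], [21, 23, 6, 5, 27], [22, 8, 27, 24, 7], [6, 7,
   26, 23, 25]]

/-- A straight-line drawing of a short block. -/
def shortPoints : List (ℤ × ℤ) :=
  [(150, 187), (113, 150), (100, 100), (113, 50), (150, 13), (250, 190), (287, 150), (300, 100),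
   (287, 50), (250, 10), (136, 128), (145, 152), (147, 164), (153, 84), (161, 161), (166, 170),
   (168, 155), (170, 48), (181, 166), (193, 175), (209, 36), (216, 166), (226, 58), (245, 92),
   (247, 45), (261, 69)]

/-- A straight-line drawing of a long block. -/
def longPoints : List (ℤ × ℤ) :=
  [(150, 187), (113, 150), (100, 100), (113, 50), (150, 13), (250, 190), (287, 150), (300, 100),
   (287, 50), (250, 10), (123, 121), (128, 103), (135, 136), (137, 114), (139, 80), (143, 100),
   (153, 56), (154, 111), (158, 92), (198, 111), (206, 44), (216, 151), (230, 83), (232, 122),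
   (248, 54), (250, 146), (266, 81), (267, 120)]

/-- The distances from the source in the first block. -/
def firstDepths : List ℕ :=
  [0, 0, 0, 0, 0, 1, 2, 3, 2, 1, 1, 1, 1, 1, 2, 1, 2, 1, 2, 1, 1, 2, 2, 2, 2, 3]

/-- The relative distances from the source in a short block. -/
def shortDepths : List ℕ :=
  [0, 1, 2, 1, 0, 1, 2, 3, 2, 1, 2, 2, 1, 2, 2, 1, 3, 1, 2, 1, 1, 2, 2, 3, 2, 3]

/-- The relative distances from the source in a long block. -/
def longDepths : List ℕ :=
  [0, 1, 2, 1, 0, 1, 2, 3, 2, 1, 2, 3, 1, 2, 2, 3, 1, 2, 2, 2, 1, 1, 2, 2, 2, 2, 3, 3]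

namespace Block

/-- The number of vertices. -/
def size : Block → ℕ
  | source | sink => 1
  | first | short => 26
  | long => 28

/-- The neighbours by vertex and colour. -/
def table : Block → List (List ℕ)
  | source | sink => []
  | first | short => shortTable
  | long => longTable

/-- The table entry of a vertex and a colour. -/
def target (b : Block) (i : ℕ) (c : Fin 5) : ℕ := (b.table.getD i []).getD c 0

/-- The edge of colour `c` at the vertex `i`. -/
def step (b : Block) (i : ℕ) (c : Fin 5) : Step :=
  match b with
  | source => .right
  | sink => .left
  | b => if i = c then .left else if i = c + 5 then .right else .inner (b.target i c)

/-- The left port of colour `c`. -/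
def leftPort : Block → Fin 5 → ℕ
  | sink, _ => 0
  | _, c => c

/-- The right port of colour `c`. -/
def rightPort : Block → Fin 5 → ℕ
  | source, _ => 0
  | _, c => c + 5

/-- The drawing of a block. -/
def points : Block → List (ℤ × ℤ)
  | source => [(0, 100)]
  | first | short => shortPoints
  | long => longPoints
  | sink => [(399, 100)]

/-- The position of a vertex in the drawing of its block. -/
def point (b : Block) (i : ℕ) : ℤ × ℤ := b.points.getD i (0, 0)

/-- The relative distances from the source. -/
def depths : Block → List ℕ
  | source => [1]
  | first => firstDepths
  | short => shortDepths
  | long => longDepths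
  | sink => [0]

/-- The relative distance of a vertex from the source. -/
def depth (b : Block) (i : ℕ) : ℕ := b.depths.getD i 0

/-- Whether the second block may follow the first one. -/
def Link : Block → Block → Bool
  | source, first => true
  | first, short | first, long | first, sink => true
  | short, short | short, long | short, sink => true
  | long, short | long, long | long, sink => true
  | _, _ => false

theorem step_eq_inner {b : Block} {i : ℕ} {c : Fin 5} {j : ℕ} (h : b.step i c = .inner j) :
    j = b.target i c := by
  cases b <;> simp only [step] at h <;> grind

/-- Naming the neighbour as `target` leaves only bounded quantifiers, so that the statement can be
decided. -/
theorem inner_spec_aux (b : Block) : ∀ i < b.size, ∀ c, b.step i c = .inner (b.target i c) →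
    b.target i c < b.size ∧ b.step (b.target i c) c = .inner i ∧ b.target i c ≠ i := by
  cases b <;> decide +kernel

theorem inner_spec {b : Block} {i j : ℕ} {c : Fin 5} (hi : i < b.size)
    (h : b.step i c = .inner j) : j < b.size ∧ b.step j c = .inner i ∧ j ≠ i := by
  obtain rfl := step_eq_inner h
  exact inner_spec_aux b i hi c h

theorem left_spec {b : Block} {i : ℕ} {c : Fin 5} (hi : i < b.size) (h : b.step i c = .left) :
    b ≠ source ∧ i = b.leftPort c := by
  cases b <;> simp only [step, size, leftPort] at h hi ⊢ <;> grind

theorem right_spec {b : Block} {i : ℕ} {c : Fin 5} (hi : i < b.size) (h : b.step i c = .right) :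
    b ≠ sink ∧ i = b.rightPort c := by
  cases b <;> simp only [step, size, rightPort] at h hi ⊢ <;> grind

theorem leftPort_spec {b : Block} (hb : b ≠ source) (c : Fin 5) :
    b.leftPort c < b.size ∧ b.step (b.leftPort c) c = .left := by
  revert hb c
  cases b <;> decide +kernel

theorem rightPort_spec {b : Block} (hb : b ≠ sink) (c : Fin 5) :
    b.rightPort c < b.size ∧ b.step (b.rightPort c) c = .right := by
  revert hb c
  cases b <;> decide +kernel

theorem leftPort_injective {b : Block} (hb : b ≠ sink) : Function.Injective b.leftPort := by
  intro c d h
  cases b <;> simp_all [leftPort, Fin.ext_iff]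

theorem rightPort_injective {b : Block} (hb : b ≠ source) : Function.Injective b.rightPort := by
  intro c d h
  cases b <;> simp_all [rightPort, Fin.ext_iff]

/-- The exceptions are the source and the sink, whose five edges all go the same way; they are told
apart only by the ports at their other ends. -/
theorem step_ne_aux (b : Block) : ∀ i < b.size, ∀ c d, c ≠ d → b.step i c = b.step i d →
    b = source ∧ b.step i c = .right ∨ b = sink ∧ b.step i c = .left := by
  cases b <;> decide +kernel

/-- Whether the walk from a vertex of a block along edges of colours `c` and `d` in turn leaves the
block through a left port. -/
def Escapes (b : Block) : ℕ → Fin 5 → Fin 5 → ℕ → Bool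
  | 0, _, _, _ => false
  | f + 1, c, d, i =>
    match b.step i c with
    | .left => true
    | .right => false
    | .inner j => b.Escapes f d c j

/-- This is what makes all pairs of colours hamiltonian, whatever the order of the blocks. The bound
28 is the largest block size, and a path inside a block has no more vertices than that. -/
theorem escapes (b : Block) (hb : b ≠ source) : ∀ i < b.size, ∀ c d : Fin 5, c ≠ d →
    (b.Escapes 28 c d i || b.Escapes 28 d c i) = true := by
  cases b
  · exact absurd rfl hb
  all_goals decide +kernel

end Block

/-! ### Chains of blocks and their coloured graphs. -/

/-- A sequence of blocks leading from a source to a sink. -/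
structure BlockChain where
  block : ℕ → Block
  length : ℕ
  block_zero : block 0 = .source
  block_length : block length = .sink
  link : ∀ k < length, (block k).Link (block (k + 1)) = true

namespace BlockChain

open Block

variable (T : BlockChain)

/-- The vertices: pairs of a position in the chain and a vertex of the block there. -/
def Vertex : Type := {p : ℕ × ℕ // p.1 ≤ T.length ∧ p.2 < (T.block p.1).size}

/-- The neighbour along an edge of the given colour. -/
def nbr (c : Fin 5) (p : ℕ × ℕ) : ℕ × ℕ :=
  match (T.block p.1).step p.2 c with
  | .inner j => (p.1, j)
  | .left => (p.1 - 1, (T.block (p.1 - 1)).rightPort c)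
  | .right => (p.1 + 1, (T.block (p.1 + 1)).leftPort c)

variable {T}

theorem ne_sink_of_lt {k : ℕ} (h : k < T.length) : T.block k ≠ sink := by
  intro e
  have := T.link k h
  rw [e] at this
  cases hb : T.block (k + 1) <;> simp [Link] at this

theorem ne_source_of_pos {k : ℕ} (h0 : 0 < k) (h : k ≤ T.length) : T.block k ≠ source := by
  intro e
  obtain ⟨k, rfl⟩ := Nat.exists_eq_add_of_lt h0
  have := T.link (0 + k) (by omega)
  rw [e] at this
  cases hb : T.block (0 + k) <;> simp [Link] at this

theorem pos_of_ne_source {k : ℕ} (h : T.block k ≠ source) : 0 < k := by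
  rcases Nat.eq_zero_or_pos k with rfl | h'
  · exact absurd T.block_zero h
  · exact h'

theorem lt_of_ne_sink {k : ℕ} (hk : k ≤ T.length) (h : T.block k ≠ sink) : k < T.length := by
  rcases hk.eq_or_lt with rfl | h'
  · exact absurd T.block_length h
  · exact h'

/-- A neighbour lies in the same block, or it is a port of an adjacent block. -/
theorem nbr_cases (p : T.Vertex) (c : Fin 5) :
    (∃ j, (T.block p.1.1).step p.1.2 c = .inner j ∧ T.nbr c p.1 = (p.1.1, j)) ∨
    (∃ k, p.1.1 = k + 1 ∧ (T.block p.1.1).step p.1.2 c = .left ∧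
      p.1.2 = (T.block p.1.1).leftPort c ∧ T.nbr c p.1 = (k, (T.block k).rightPort c)) ∨
    (p.1.1 < T.length ∧ (T.block p.1.1).step p.1.2 c = .right ∧
      p.1.2 = (T.block p.1.1).rightPort c ∧
      T.nbr c p.1 = (p.1.1 + 1, (T.block (p.1.1 + 1)).leftPort c)) := by
  obtain ⟨⟨k, i⟩, hk, hi⟩ := p
  simp only at hk hi ⊢
  rcases h : (T.block k).step i c with j | _ | _
  · exact Or.inl ⟨j, rfl, by simp [nbr, h]⟩
  · obtain ⟨h1, h2⟩ := left_spec hi h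
    have := pos_of_ne_source h1
    exact Or.inr (Or.inl ⟨k - 1, by omega, rfl, h2, by simp [nbr, h]⟩)
  · obtain ⟨h1, h2⟩ := right_spec hi h
    exact Or.inr (Or.inr ⟨lt_of_ne_sink hk h1, rfl, h2, by simp [nbr, h]⟩)

theorem nbr_mem (p : T.Vertex) (c : Fin 5) :
    (T.nbr c p.1).1 ≤ T.length ∧ (T.nbr c p.1).2 < (T.block (T.nbr c p.1).1).size := by
  have hk := p.2.1
  rcases nbr_cases p c with ⟨j, h, e⟩ | ⟨k, e1, -, -, e⟩ | ⟨h1, -, -, e⟩ <;> rw [e]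
  · exact ⟨hk, (inner_spec p.2.2 h).1⟩
  · exact ⟨by simp only; omega, (rightPort_spec (ne_sink_of_lt (by omega)) c).1⟩
  · exact ⟨h1, (leftPort_spec (ne_source_of_pos (by omega) h1) c).1⟩

theorem nbr_nbr (p : T.Vertex) (c : Fin 5) : T.nbr c (T.nbr c p.1) = p.1 := by
  have hk := p.2.1
  rcases nbr_cases p c with ⟨j, h, e⟩ | ⟨k, e1, -, e2, e⟩ | ⟨h1, -, e2, e⟩ <;> rw [e]
  · simp only [nbr, (inner_spec p.2.2 h).2.1]
  · have : T.block k ≠ sink := ne_sink_of_lt (by omega)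
    simp only [nbr, (rightPort_spec this c).2]
    rw [← e1, ← e2]
  · have : T.block (p.1.1 + 1) ≠ source := ne_source_of_pos (by omega) h1
    simp only [nbr, (leftPort_spec this c).2]
    rw [Nat.add_sub_cancel, ← e2]

theorem nbr_ne (p : T.Vertex) (c : Fin 5) : T.nbr c p.1 ≠ p.1 := by
  intro h
  rcases nbr_cases p c with ⟨j, hj, e⟩ | ⟨k, e1, -, -, e⟩ | ⟨h1, -, -, e⟩ <;> rw [e] at h <;>
    have h1 := congrArg Prod.fst h <;> have h2 := congrArg Prod.snd h <;> simp only at h1 h2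
  · exact (inner_spec p.2.2 hj).2.2 h2
  · omega
  · omega

theorem nbr_injective (p : T.Vertex) : Function.Injective fun c => T.nbr c p.1 := by
  intro c d h
  by_contra hcd
  have hst := step_ne_aux (T.block p.1.1) p.1.2 p.2.2 c d hcd
  have hk := p.2.1
  simp only at h
  rcases nbr_cases p c with ⟨j, h1, e⟩ | ⟨k, e1, h1, -, e⟩ | ⟨h0, h1, -, e⟩ <;>
    rcases nbr_cases p d with ⟨j', h1', e'⟩ | ⟨k', e1', h1', -, e'⟩ | ⟨h0', h1', -, e'⟩ <;>
    rw [e, e', Prod.mk.injEq] at h <;> obtain ⟨h2, h3⟩ := h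
  · subst h3
    have := hst (h1.trans h1'.symm)
    simp [h1] at this
  · omega
  · omega
  · omega
  · subst h2
    have := hst (h1.trans h1'.symm)
    -- Here the block is the sink. Directly after the source it would produce five parallel edges,
    -- which `Link` forbids; otherwise the right ports before it are distinct.
    rcases Nat.eq_zero_or_pos k with rfl | hkp
    · have hl := T.link 0 (by omega)
      simp only [h1, reduceCtorEq, and_false, false_or, and_true] at this
      rw [e1] at this
      rw [T.block_zero, this] at hl
      simp [Link] at hl
    · exact hcd (rightPort_injective (ne_source_of_pos hkp (by omega)) h3)
  · omega
  · omega
  · omega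
  · have := hst (h1.trans h1'.symm)
    simp only [h1, reduceCtorEq, and_false, or_false, and_true] at this
    have hs : T.block (p.1.1 + 1) ≠ sink := by
      intro hs
      have hl := T.link _ h0
      rw [this, hs] at hl
      simp [Link] at hl
    exact hcd (leftPort_injective hs h3)

variable (T)

/-- The coloured graph of a chain of blocks. -/
def coloured : ColouredNeighbours T.Vertex where
  nb c p := ⟨T.nbr c p.1, nbr_mem p c⟩
  nb_nb c p := Subtype.ext (nbr_nbr p c)
  nb_ne c p h := nbr_ne p c (congrArg Subtype.val h)
  nb_injective p _ _ h := nbr_injective p (congrArg Subtype.val h)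

/-- The vertex of the source. -/
def root : T.Vertex := ⟨(0, 0), by simp [T.block_zero, size]⟩

instance : Nonempty T.Vertex := ⟨T.root⟩

theorem eq_root {p : T.Vertex} (h : p.1.1 = 0) : p = T.root := by
  obtain ⟨⟨k, i⟩, hk, hi⟩ := p
  simp only at h
  subst h
  simp only [T.block_zero, size] at hi
  obtain rfl : i = 0 := by omega
  rfl

variable {T}

/-- Each inner step exchanges the roles of the two colours, which does not change the pair graph. -/
theorem exists_reachable_of_escapes {f : ℕ} : ∀ {c d : Fin 5} (p : T.Vertex),
    (T.block p.1.1).Escapes f c d p.1.2 = true →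
    ∃ q : T.Vertex, q.1.1 + 1 = p.1.1 ∧ (T.coloured.pairGraph c d).Reachable p q := by
  induction f with
  | zero => intro _ _ p h; simp [Escapes] at h
  | succ f ih =>
    intro c d p h
    have hadj : (T.coloured.pairGraph c d).Adj p (T.coloured.nb c p) := Or.inl rfl
    rcases nbr_cases p c with ⟨j, h1, e⟩ | ⟨k, e1, h1, -, e⟩ | ⟨h0, h1, -, e⟩
    · simp only [Escapes, h1] at h
      have hq : (T.coloured.nb c p).1 = (p.1.1, j) := e
      obtain ⟨q, hq1, hq2⟩ := ih (c := d) (d := c) (T.coloured.nb c p) (by rw [hq]; exact h)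
      refine ⟨q, by rw [hq1, hq], hadj.reachable.trans ?_⟩
      have : T.coloured.pairGraph c d = T.coloured.pairGraph d c := by
        ext u v
        exact or_comm
      rwa [this]
    · exact ⟨T.coloured.nb c p, by rw [e1]; exact congrArg (·.1 + 1) e, hadj.reachable⟩
    · simp [Escapes, h1] at h

theorem pairGraph_preconnected {c d : Fin 5} (h : c ≠ d) :
    (T.coloured.pairGraph c d).Preconnected := by
  have key : ∀ (k : ℕ) (p : T.Vertex), p.1.1 = k →
      (T.coloured.pairGraph c d).Reachable p T.root := by
    intro k
    induction k with
    | zero => intro p hp; rw [T.eq_root hp]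
    | succ k ih =>
      intro p hp
      have hs := escapes _ (ne_source_of_pos (k := p.1.1) (by omega) p.2.1) p.1.2 p.2.2 c d h
      rw [Bool.or_eq_true] at hs
      obtain ⟨q, hq, hr⟩ : ∃ q : T.Vertex, q.1.1 + 1 = p.1.1 ∧
          (T.coloured.pairGraph c d).Reachable p q := by
        rcases hs with hs | hs
        · exact exists_reachable_of_escapes p hs
        · have : T.coloured.pairGraph c d = T.coloured.pairGraph d c := by
            ext u v
            exact or_comm
          rw [this]
          exact exists_reachable_of_escapes p hs
      exact hr.trans (ih q (by omega))
  exact fun u v => (key _ u rfl).trans (key _ v rfl).symm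

end BlockChain

/-! ### The plane drawing of a chain. -/

theorem SegmentsApart.symm {R : Type*} [CommRing R] [LinearOrder R] {p q r s : R × R}
    (h : SegmentsApart p q r s) : SegmentsApart r s p q :=
  h.imp Or.symm Or.symm

theorem SegmentsApart.swap_left {R : Type*} [CommRing R] [LinearOrder R] {p q r s : R × R}
    (h : SegmentsApart p q r s) : SegmentsApart q p r s := by
  have e : ∀ x : R × R, orient q p x = -orient p q x := by
    intro x
    simp only [orient]
    ring
  simp only [SegmentsApart, e, neg_mul_neg, max_comm q.1, min_comm q.1,
    mul_comm (orient r s q)] at h ⊢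
  exact h

theorem SegmentsApart.swap_right {R : Type*} [CommRing R] [LinearOrder R] {p q r s : R × R}
    (h : SegmentsApart p q r s) : SegmentsApart p q s r :=
  h.symm.swap_left.symm

/-- The horizontal translate by `z` of an integer point, as a real point. -/
def shiftCast (z : ℤ) (p : ℤ × ℤ) : ℝ × ℝ := (((p.1 + z : ℤ) : ℝ), (p.2 : ℝ))

theorem orient_shiftCast (z : ℤ) (p q r : ℤ × ℤ) :
    orient (shiftCast z p) (shiftCast z q) (shiftCast z r) = (orient p q r : ℤ) := by
  simp only [orient, shiftCast]
  push_cast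
  ring

theorem SegmentsApart.shiftCast {p q r s : ℤ × ℤ} (h : SegmentsApart p q r s) (z : ℤ) :
    SegmentsApart (shiftCast z p) (shiftCast z q) (shiftCast z r) (shiftCast z s) := by
  simp only [SegmentsApart, orient_shiftCast]
  simp only [SegmentsApart, max_lt_iff, lt_min_iff, _root_.shiftCast] at h ⊢
  refine h.imp (Or.imp ?_ ?_) (Or.imp ?_ ?_)
  · rintro ⟨⟨h1, h2⟩, h3, h4⟩
    refine ⟨⟨?_, ?_⟩, ?_, ?_⟩ <;> exact_mod_cast by omega
  · rintro ⟨⟨h1, h2⟩, h3, h4⟩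
    refine ⟨⟨?_, ?_⟩, ?_, ?_⟩ <;> exact_mod_cast by omega
  · intro h
    exact_mod_cast h
  · intro h
    exact_mod_cast h

namespace Block

/-- The position of the right port of a colour. -/
def rightPoint (b : Block) (c : Fin 5) : ℤ × ℤ := b.point (b.rightPort c)

/-- The position of the left port of a colour. -/
def leftPoint (b : Block) (c : Fin 5) : ℤ × ℤ := b.point (b.leftPort c)

/-- The position of a neighbour relative to the block `b`, when the adjacent ports have the
positions `l` and `r` in their blocks. -/
def nbrPoint (l : Fin 5 → ℤ × ℤ) (b : Block) (r : Fin 5 → ℤ × ℤ) (i : ℕ) (c : Fin 5) : ℤ × ℤ :=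
  match b.step i c with
  | .inner j => b.point j
  | .left => ((l c).1 - 400, (l c).2)
  | .right => ((r c).1 + 400, (r c).2)

/-- A Boolean test for integer segments to be apart. -/
def apartTest (p q r s : ℤ × ℤ) : Bool :=
  let o (p q r : ℤ × ℤ) : ℤ := (q.1 - p.1) * (r.2 - p.2) - (q.2 - p.2) * (r.1 - p.1)
  ((decide (p.1 < r.1) && decide (q.1 < r.1)) && (decide (p.1 < s.1) && decide (q.1 < s.1))) ||
  ((decide (r.1 < p.1) && decide (s.1 < p.1)) && (decide (r.1 < q.1) && decide (s.1 < q.1))) ||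
  decide (0 < o p q r * o p q s) || decide (0 < o r s p * o r s q)

theorem segmentsApart_of_apartTest {p q r s : ℤ × ℤ} (h : apartTest p q r s = true) :
    SegmentsApart p q r s := by
  simp only [apartTest, Bool.or_eq_true, Bool.and_eq_true, decide_eq_true_eq] at h
  simp only [SegmentsApart, max_lt_iff, lt_min_iff, orient]
  tauto

/-- Edges at distinct vertices of a block without a common end are apart. -/
def crossTest (l : Fin 5 → ℤ × ℤ) (b : Block) (r : Fin 5 → ℤ × ℤ) : Bool :=
  (List.range b.size).all fun i => (List.range i).all fun j =>
    (List.finRange 5).all fun c => (List.finRange 5).all fun d =>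
      let p := b.point i
      let q := nbrPoint l b r i c
      let p' := b.point j
      let q' := nbrPoint l b r j d
      apartTest p q p' q' || decide (p = p') || decide (p = q') || decide (q = p') || decide (q = q')

/-- Edges at a common vertex of a block are not parallel. -/
def angleTest (l : Fin 5 → ℤ × ℤ) (b : Block) (r : Fin 5 → ℤ × ℤ) : Bool :=
  (List.range b.size).all fun i =>
    (List.finRange 5).all fun c => (List.finRange 5).all fun d =>
      decide (c = d) ||
        decide (orient (b.point i) (nbrPoint l b r i c) (nbrPoint l b r i d) ≠ 0)

/-- Vacuous, since a single vertex gives no pair of distinct vertices; hence the neighbouring blocks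
are arbitrary. -/
theorem crossTest_source (l r : Block) :
    crossTest l.rightPoint source r.leftPoint = true := by
  cases l <;> cases r <;> decide +kernel

theorem crossTest_sink (l r : Block) :
    crossTest l.rightPoint sink r.leftPoint = true := by
  cases l <;> cases r <;> decide +kernel

theorem crossTest_source_first_short :
    crossTest source.rightPoint first short.leftPoint = true := by decide +kernel

theorem crossTest_source_first_sink :
    crossTest source.rightPoint first sink.leftPoint = true := by decide +kernel

theorem crossTest_first_short_short :
    crossTest first.rightPoint short short.leftPoint = true := by decide +kernel

theorem crossTest_first_short_sink :
    crossTest first.rightPoint short sink.leftPoint = true := by decide +kernel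

theorem crossTest_first_long_short :
    crossTest first.rightPoint long short.leftPoint = true := by decide +kernel

theorem crossTest_first_long_sink :
    crossTest first.rightPoint long sink.leftPoint = true := by decide +kernel

/-- The drawings agree at the ports, so the crossing test depends only on the block itself and on
whether a neighbour is an end of the chain. The six checks above then cover all the remaining cases.
-/
theorem rightPoint_short : rightPoint short = rightPoint first := by decide +kernel

theorem rightPoint_long : rightPoint long = rightPoint first := by decide +kernel

theorem leftPoint_long : leftPoint long = leftPoint short := by decide +kernel

theorem crossTest_eq_true {l b r : Block} (hl : b ≠ source → l.Link b = true)
    (hr : b ≠ sink → b.Link r = true) : crossTest l.rightPoint b r.leftPoint = true := by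
  cases b
  case source => exact crossTest_source l r
  case sink => exact crossTest_sink l r
  all_goals
    cases l <;> simp [Link] at hl <;> cases r <;> simp [Link] at hr <;>
    simp only [rightPoint_short, rightPoint_long, leftPoint_long, crossTest_source_first_short,
      crossTest_source_first_sink, crossTest_first_short_short, crossTest_first_short_sink,
      crossTest_first_long_short, crossTest_first_long_sink]

theorem angleTest_eq_true {l b r : Block} (hl : b ≠ source → l.Link b = true)
    (hr : b ≠ sink → b.Link r = true) : angleTest l.rightPoint b r.leftPoint = true := by
  cases b <;> cases l <;> simp [Link] at hl <;> cases r <;> simp [Link] at hr <;> decide +kernel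

theorem point_fst_mem (b : Block) :
    ∀ i < b.size, 0 ≤ (b.point i).1 ∧ (b.point i).1 < 400 := by
  cases b <;> decide +kernel

theorem point_injective (b : Block) :
    ∀ i < b.size, ∀ j < b.size, b.point i = b.point j → i = j := by
  cases b <;> decide +kernel

end Block

namespace BlockChain

open Block

variable {T : BlockChain}

theorem link_left (p : T.Vertex) (h : T.block p.1.1 ≠ source) :
    (T.block (p.1.1 - 1)).Link (T.block p.1.1) = true := by
  have h0 := pos_of_ne_source h
  have h1 := p.2.1
  have := T.link (p.1.1 - 1) (by omega)
  rwa [Nat.sub_add_cancel h0] at this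

theorem link_right (p : T.Vertex) (h : T.block p.1.1 ≠ sink) :
    (T.block p.1.1).Link (T.block (p.1.1 + 1)) = true :=
  T.link _ (lt_of_ne_sink p.2.1 h)

variable (T) in
/-- The drawing of the graph of a chain of blocks. -/
def pos (p : T.Vertex) : ℝ × ℝ := shiftCast (400 * p.1.1) ((T.block p.1.1).point p.1.2)

theorem pos_nb (p : T.Vertex) (c : Fin 5) : T.pos (T.coloured.nb c p) =
    shiftCast (400 * p.1.1) (nbrPoint (T.block (p.1.1 - 1)).rightPoint (T.block p.1.1)
      (T.block (p.1.1 + 1)).leftPoint p.1.2 c) := by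
  change shiftCast (400 * (T.nbr c p.1).1) ((T.block (T.nbr c p.1).1).point (T.nbr c p.1).2) = _
  rcases nbr_cases p c with ⟨j, h, e⟩ | ⟨k, e1, h, -, e⟩ | ⟨-, h, -, e⟩ <;> rw [e] <;>
    simp only [nbrPoint, h]
  · have : p.1.1 - 1 = k := by omega
    rw [this, e1]
    simp only [shiftCast, rightPoint]
    push_cast
    exact Prod.ext (by ring) rfl
  · simp only [shiftCast, leftPoint]
    push_cast
    exact Prod.ext (by ring) rfl

theorem pos_fst_mem (p : T.Vertex) :
    (400 * p.1.1 : ℝ) ≤ (T.pos p).1 ∧ (T.pos p).1 < 400 * p.1.1 + 400 := by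
  have h := point_fst_mem _ _ p.2.2
  have h1 : (0 : ℝ) ≤ ((T.block p.1.1).point p.1.2).1 := by exact_mod_cast h.1
  have h2 : (((T.block p.1.1).point p.1.2).1 : ℝ) < 400 := by exact_mod_cast h.2
  simp only [pos, shiftCast]
  push_cast
  constructor <;> linarith

theorem pos_fst_lt {p q : T.Vertex} (h : p.1.1 < q.1.1) : (T.pos p).1 < (T.pos q).1 := by
  have hp := (pos_fst_mem p).2
  have hq := (pos_fst_mem q).1
  have : (p.1.1 + 1 : ℝ) ≤ q.1.1 := by exact_mod_cast h
  linarith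

theorem shiftCast_injective (z : ℤ) : Function.Injective (shiftCast z) := by
  rintro ⟨a, b⟩ ⟨c, d⟩ h
  simpa [shiftCast] using h

theorem pos_injective : Function.Injective T.pos := by
  intro p q h
  rcases lt_trichotomy p.1.1 q.1.1 with hl | he | hl
  · exact absurd (congrArg Prod.fst h) (pos_fst_lt hl).ne
  · obtain ⟨⟨k, i⟩, hk, hi⟩ := p
    obtain ⟨⟨k', j⟩, hk', hj⟩ := q
    simp only at he
    subst he
    have := point_injective _ i hi j hj (shiftCast_injective _ h)
    subst this
    rfl
  · exact absurd (congrArg Prod.fst h) (pos_fst_lt hl).ne'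

theorem orient_pos_ne_zero (p : T.Vertex) {c d : Fin 5} (h : c ≠ d) :
    orient (T.pos p) (T.pos (T.coloured.nb c p)) (T.pos (T.coloured.nb d p)) ≠ 0 := by
  have ht := angleTest_eq_true (link_left p) (link_right p)
  simp only [angleTest, List.all_eq_true, List.mem_range, List.mem_finRange, Bool.or_eq_true,
    decide_eq_true_eq, true_imp_iff] at ht
  rw [pos_nb, pos_nb, pos, orient_shiftCast]
  exact_mod_cast (ht p.1.2 p.2.2 c d).resolve_left h

theorem segmentsApart_of_snd_lt {p q : T.Vertex} (he : p.1.1 = q.1.1) (hlt : q.1.2 < p.1.2)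
    (c d : Fin 5) (h2 : p ≠ T.coloured.nb d q) (h3 : T.coloured.nb c p ≠ q)
    (h4 : T.coloured.nb c p ≠ T.coloured.nb d q) :
    SegmentsApart (T.pos p) (T.pos (T.coloured.nb c p)) (T.pos q) (T.pos (T.coloured.nb d q)) := by
  have ht := crossTest_eq_true (link_left p) (link_right p)
  simp only [crossTest, List.all_eq_true, List.mem_range, List.mem_finRange, Bool.or_eq_true,
    decide_eq_true_eq, true_imp_iff] at ht
  have h1 : p ≠ q := fun e => hlt.ne (by rw [e])
  rw [← pos_injective.ne_iff] at h1 h2 h3 h4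
  simp only [pos_nb] at h1 h2 h3 h4 ⊢
  simp only [pos, ← he, (shiftCast_injective _).ne_iff] at h1 h2 h3 h4 ⊢
  have := ht p.1.2 p.2.2 q.1.2 hlt c d
  simp only [h1, h2, h3, h4, or_false] at this
  exact (segmentsApart_of_apartTest this).shiftCast _

theorem segmentsApart_of_fst_eq {a b c d : T.Vertex} (hab : T.coloured.graph.Adj a b)
    (hcd : T.coloured.graph.Adj c d) (he : a.1.1 = c.1.1)
    (hac : a ≠ c) (had : a ≠ d) (hbc : b ≠ c) (hbd : b ≠ d) :
    SegmentsApart (T.pos a) (T.pos b) (T.pos c) (T.pos d) := by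
  obtain ⟨x, rfl⟩ := hab
  obtain ⟨y, rfl⟩ := hcd
  rcases lt_trichotomy a.1.2 c.1.2 with h | h | h
  · exact (segmentsApart_of_snd_lt he.symm h y x hbc.symm had.symm hbd.symm).symm
  · exact absurd (Subtype.ext (Prod.ext he h)) hac
  · exact segmentsApart_of_snd_lt he h x y had hbc hbd

theorem fst_le_of_adj {a b : T.Vertex} (h : T.coloured.graph.Adj a b) : a.1.1 ≤ b.1.1 + 1 := by
  obtain ⟨c, rfl⟩ := h
  change a.1.1 ≤ (T.nbr c a.1).1 + 1
  rcases nbr_cases a c with ⟨j, h, e⟩ | ⟨k, e1, h, -, e⟩ | ⟨-, h, -, e⟩ <;> rw [e] <;>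
    simp only <;> omega

theorem segmentsApart_of_lt {a b c d : T.Vertex} (h1 : a.1.1 < c.1.1) (h2 : a.1.1 < d.1.1)
    (h3 : b.1.1 < c.1.1) (h4 : b.1.1 < d.1.1) :
    SegmentsApart (T.pos a) (T.pos b) (T.pos c) (T.pos d) := by
  refine Or.inl (Or.inl ?_)
  simp only [max_lt_iff, lt_min_iff]
  exact ⟨⟨pos_fst_lt h1, pos_fst_lt h3⟩, pos_fst_lt h2, pos_fst_lt h4⟩

/-- An edge spans at most two consecutive blocks. If no end of one edge shares a block with an end
of the other, the edges occupy separate ranges of strips. -/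
theorem segmentsApart_of_adj {a b c d : T.Vertex} (hab : T.coloured.graph.Adj a b)
    (hcd : T.coloured.graph.Adj c d) (hac : a ≠ c) (had : a ≠ d) (hbc : b ≠ c) (hbd : b ≠ d) :
    SegmentsApart (T.pos a) (T.pos b) (T.pos c) (T.pos d) := by
  by_cases e1 : a.1.1 = c.1.1
  · exact segmentsApart_of_fst_eq hab hcd e1 hac had hbc hbd
  by_cases e2 : a.1.1 = d.1.1
  · exact (segmentsApart_of_fst_eq hab hcd.symm e2 had hac hbd hbc).swap_right
  by_cases e3 : b.1.1 = c.1.1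
  · exact (segmentsApart_of_fst_eq hab.symm hcd e3 hbc hbd hac had).swap_left
  by_cases e4 : b.1.1 = d.1.1
  · exact (segmentsApart_of_fst_eq hab.symm hcd.symm e4 hbd hbc had hac).swap_left.swap_right
  have i1 := fst_le_of_adj hab
  have i2 := fst_le_of_adj hab.symm
  have i3 := fst_le_of_adj hcd
  have i4 := fst_le_of_adj hcd.symm
  rcases lt_or_gt_of_ne e1 with h | h
  · exact segmentsApart_of_lt h (by omega) (by omega) (by omega)
  · exact (segmentsApart_of_lt h (by omega) (by omega) (by omega)).symm

end BlockChain

/-- Planarity of a transported graph of a chain of blocks. -/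
theorem BlockChain.isPlanarGraph_congr (T : BlockChain) {W : Type*} (e : T.Vertex ≃ W) :
    IsPlanarGraph (T.coloured.congr e).graph := by
  have hadj : ∀ {u v}, (T.coloured.congr e).graph.Adj u v →
      T.coloured.graph.Adj (e.symm u) (e.symm v) := by
    rintro u _ ⟨c, rfl⟩
    exact ⟨c, by simp [ColouredNeighbours.congr]⟩
  refine isPlanarGraph_of_straight (fun w => T.pos (e.symm w))
    (pos_injective.comp e.symm.injective) (fun v => ⟨_, 0, rfl⟩) ?_ ?_
  · rintro u v w huv huw hvw
    obtain ⟨c, hc⟩ := hadj huv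
    obtain ⟨d, hd⟩ := hadj huw
    have hcd : c ≠ d := by
      rintro rfl
      exact hvw (e.symm.injective (hc.symm.trans hd))
    have := orient_pos_ne_zero (e.symm u) hcd
    rwa [hc, hd] at this
  · intro a b c d hab hcd h1 h2 h3 h4
    exact segmentsApart_of_adj (hadj hab) (hadj hcd) (e.symm.injective.ne h1)
      (e.symm.injective.ne h2) (e.symm.injective.ne h3) (e.symm.injective.ne h4)

/-! ### Distances from the source and recovery of the word. -/

open Polynomial in
/-- The generating polynomial of the relative distances in a block. -/
noncomputable def Block.depthPoly (b : Block) : ℤ[X] :=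
  ∑ i ∈ Finset.range b.size, X ^ b.depth i

namespace Block

theorem depth_inner_aux (b : Block) : ∀ i < b.size, ∀ c, b.step i c = .inner (b.target i c) →
    b.depth i ≤ b.depth (b.target i c) + 1 := by
  cases b <;> decide +kernel

/-- Since passing to the next block adds two, these bounds say that the absolute depths at the two
ends of a linking edge differ by at most one. -/
theorem depth_link {l r : Block} (h : l.Link r = true) (c : Fin 5) :
    l.depth (l.rightPort c) ≤ r.depth (r.leftPort c) + 3 ∧
      r.depth (r.leftPort c) + 1 ≤ l.depth (l.rightPort c) := by
  revert c
  cases l <;> cases r <;> first | exact absurd h (by decide) | decide +kernel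

/-- Every vertex outside the source has a neighbour one step nearer to it, in the same block or in
the previous one. -/
theorem depth_descent {l b : Block} (h : l.Link b = true) : ∀ i < b.size, ∃ c,
    b.step i c = .inner (b.target i c) ∧ b.depth (b.target i c) + 1 = b.depth i ∨
      b.step i c = .left ∧ l.depth (l.rightPort c) = b.depth i + 1 := by
  cases l <;> cases b <;> first | exact absurd h (by decide) | decide +kernel

theorem depthPoly_eval_one (b : Block) : b.depthPoly.eval 1 = b.size := by
  simp [depthPoly, Polynomial.eval_finsetSum]

end Block

namespace BlockChain

open Block

variable (T : BlockChain)

/-- The distance from the root, plus one. -/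
def depth (p : T.Vertex) : ℕ := 2 * p.1.1 + (T.block p.1.1).depth p.1.2

theorem depth_root : T.depth T.root = 1 := by
  simp [depth, root, T.block_zero, Block.depth, depths]

variable {T}

theorem depth_le_depth_nb (p : T.Vertex) (c : Fin 5) :
    T.depth p ≤ T.depth (T.coloured.nb c p) + 1 := by
  change 2 * p.1.1 + (T.block p.1.1).depth p.1.2 ≤
    2 * (T.nbr c p.1).1 + (T.block (T.nbr c p.1).1).depth (T.nbr c p.1).2 + 1
  have hk := p.2.1
  rcases nbr_cases p c with ⟨j, h, e⟩ | ⟨k, e1, -, e2, e⟩ | ⟨h1, -, e2, e⟩ <;> rw [e] <;>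
    simp only
  · obtain rfl := step_eq_inner h
    have := depth_inner_aux _ _ p.2.2 c h
    omega
  · have := depth_link (T.link k (by omega)) c
    rw [← e1, ← e2] at this
    omega
  · have := depth_link (T.link _ h1) c
    rw [← e2] at this
    omega

theorem exists_depth_nb_add_one (p : T.Vertex) (hp : p ≠ T.root) :
    ∃ c, T.depth (T.coloured.nb c p) + 1 = T.depth p := by
  have hpos : 0 < p.1.1 := Nat.pos_of_ne_zero fun h => hp (T.eq_root h)
  obtain ⟨c, hc⟩ := depth_descent (link_left p (ne_source_of_pos hpos p.2.1)) p.1.2 p.2.2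
  refine ⟨c, ?_⟩
  change 2 * (T.nbr c p.1).1 + (T.block (T.nbr c p.1).1).depth (T.nbr c p.1).2 + 1 =
    2 * p.1.1 + (T.block p.1.1).depth p.1.2
  rcases hc with ⟨h1, h2⟩ | ⟨h1, h2⟩ <;> simp only [nbr, h1] <;> omega

/-- Follow a descending path to the root in `S`: along its image the depth in `T` changes by at most
one per edge. -/
theorem depth_iso_le {S T : BlockChain} (φ : S.coloured.graph ≃g T.coloured.graph)
    (h : φ S.root = T.root) (p : S.Vertex) : T.depth (φ p) ≤ S.depth p := by
  induction hn : S.depth p using Nat.strong_induction_on generalizing p with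
  | _ n ih =>
    subst hn
    by_cases hp : p = S.root
    · rw [hp, h, depth_root, depth_root]
    · obtain ⟨c, hc⟩ := exists_depth_nb_add_one p hp
      have hq := ih _ (by omega) (S.coloured.nb c p) rfl
      obtain ⟨d, hd⟩ := φ.map_rel_iff.2 (⟨c, rfl⟩ : S.coloured.graph.Adj p (S.coloured.nb c p))
      have := depth_le_depth_nb (φ p) d
      rw [hd] at this
      exact this.trans (by omega)

theorem depth_iso {S T : BlockChain} (φ : S.coloured.graph ≃g T.coloured.graph)
    (h : φ S.root = T.root) (p : S.Vertex) : T.depth (φ p) = S.depth p := by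
  refine (depth_iso_le φ h p).antisymm ?_
  have h' : φ.symm T.root = S.root := by rw [← h, RelIso.symm_apply_apply]
  simpa using depth_iso_le φ.symm h' (φ p)

variable (T) in
/-- The vertices as a sum type. -/
def vertexEquiv : T.Vertex ≃ Σ k : Fin (T.length + 1), Fin (T.block k).size where
  toFun p := ⟨⟨p.1.1, Nat.lt_succ_of_le p.2.1⟩, ⟨p.1.2, p.2.2⟩⟩
  invFun q := ⟨(q.1, q.2), Nat.le_of_lt_succ q.1.2, q.2.2⟩
  left_inv _ := rfl
  right_inv _ := rfl

instance : Fintype T.Vertex := Fintype.ofEquiv _ T.vertexEquiv.symm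

theorem card_vertex :
    Fintype.card T.Vertex = ∑ k ∈ Finset.range (T.length + 1), (T.block k).size := by
  rw [Fintype.card_congr T.vertexEquiv, Fintype.card_sigma, Finset.sum_range]
  simp

open Polynomial in
theorem sum_X_pow_depth : ∑ p : T.Vertex, (X : ℤ[X]) ^ T.depth p =
    ∑ k ∈ Finset.range (T.length + 1), X ^ (2 * k) * (T.block k).depthPoly := by
  rw [← T.vertexEquiv.symm.sum_comp, Fintype.sum_sigma, Finset.sum_range]
  refine Finset.sum_congr rfl fun k _ => ?_
  rw [depthPoly, Finset.mul_sum, Finset.sum_range]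
  refine Finset.sum_congr rfl fun i _ => ?_
  rw [← pow_add]
  rfl

theorem sum_depthPoly_eq_of_iso {S T : BlockChain} (φ : S.coloured.graph ≃g T.coloured.graph)
    (h : φ S.root = T.root) :
    ∑ k ∈ Finset.range (S.length + 1), Polynomial.X ^ (2 * k) * (S.block k).depthPoly =
      ∑ k ∈ Finset.range (T.length + 1), Polynomial.X ^ (2 * k) * (T.block k).depthPoly := by
  rw [← sum_X_pow_depth, ← sum_X_pow_depth, ← φ.toEquiv.sum_comp]
  exact Finset.sum_congr rfl fun p _ => by rw [← depth_iso φ h p]; rfl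

/-- A long block for `true`, a short one for `false`. -/
def letter (x : Bool) : Block := if x then .long else .short

/-- The chain of blocks spelling the first `m` letters of a word. -/
def ofWord (s : ℕ → Bool) (m : ℕ) : BlockChain where
  block
    | 0 => .source
    | 1 => .first
    | k + 2 => if k < m then letter (s k) else .sink
  length := m + 2
  block_zero := rfl
  block_length := by simp
  link k hk := by
    rcases k with _ | _ | k
    · rfl
    · rcases Nat.eq_zero_or_pos m with rfl | hm
      · rfl
      · cases h : s 0 <;> simp [hm, letter, h, Link]
    · have hk : k < m := by omega
      by_cases hk' : k + 1 < m <;> cases h : s k <;> cases h' : s (k + 1) <;>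
        simp [hk, hk', letter, h, h', Link]

theorem card_ofWord (s : ℕ → Bool) (m : ℕ) : Fintype.card (ofWord s m).Vertex =
    28 + ∑ k ∈ Finset.range m, (letter (s k)).size := by
  rw [card_vertex]
  change ∑ k ∈ Finset.range (m + 2 + 1), _ = _
  rw [Finset.sum_range_succ, Finset.sum_range_succ', Finset.sum_range_succ']
  have : ∀ k ∈ Finset.range m, ((ofWord s m).block (k + 1 + 1)).size = (letter (s k)).size := by
    intro k hk
    simp [ofWord, Finset.mem_range.1 hk]
  rw [Finset.sum_congr rfl this]
  simp only [ofWord, size, lt_irrefl, if_false]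
  omega

open Polynomial in
theorem word_eq_of_iso {s t : ℕ → Bool} {m : ℕ}
    (φ : (ofWord s m).coloured.graph ≃g (ofWord t m).coloured.graph)
    (h : φ (ofWord s m).root = (ofWord t m).root) {j : ℕ} (hj : j < m) : s j = t j := by
  have key := sum_depthPoly_eq_of_iso φ h
  -- All terms but the last are the same for every word of length `m`. Exponents carry `k + 2`
  -- because the source and the first block precede the letters.
  have expand : ∀ s : ℕ → Bool, ∑ k ∈ Finset.range ((ofWord s m).length + 1),
      X ^ (2 * k) * ((ofWord s m).block k).depthPoly =
      (∑ k ∈ Finset.range m, X ^ (2 * (k + 2)) * short.depthPoly +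
        X ^ (2 * 1) * first.depthPoly + X ^ (2 * 0) * source.depthPoly +
        X ^ (2 * (m + 2)) * sink.depthPoly) +
      (long.depthPoly - short.depthPoly) *
        ∑ k ∈ Finset.range m, C (if s k then 1 else 0) * X ^ (2 * (k + 2)) := by
    intro s
    change ∑ k ∈ Finset.range (m + 2 + 1), _ = _
    rw [Finset.sum_range_succ, Finset.sum_range_succ', Finset.sum_range_succ']
    have : ∀ k ∈ Finset.range m,
        X ^ (2 * (k + 1 + 1)) * ((ofWord s m).block (k + 1 + 1)).depthPoly =
        X ^ (2 * (k + 2)) * short.depthPoly + (long.depthPoly - short.depthPoly) *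
          (C (if s k then 1 else 0) * X ^ (2 * (k + 2))) := by
      intro k hk
      cases hs : s k
      · simp [ofWord, Finset.mem_range.1 hk, hs, letter]
      · simp only [ofWord, Finset.mem_range.1 hk, hs, letter, if_true, map_one]
        ring
    rw [Finset.sum_congr rfl this, Finset.sum_add_distrib, ← Finset.mul_sum]
    simp only [ofWord, lt_irrefl, if_false]
    ring
  rw [expand, expand] at key
  -- At 1 the difference takes the value 28 - 26 = 2.
  have hne : long.depthPoly - short.depthPoly ≠ 0 := by
    intro h0
    have := congrArg (eval 1) h0
    simp [depthPoly_eval_one, size] at this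
  have hsum := mul_left_cancel₀ hne (add_left_cancel key)
  have hcoeff : ∀ s : ℕ → Bool, (∑ k ∈ Finset.range m,
      C (if s k then (1 : ℤ) else 0) * X ^ (2 * (k + 2))).coeff (2 * (j + 2)) =
      if s j then 1 else 0 := by
    intro s
    rw [finsetSum_coeff, Finset.sum_eq_single j]
    · rw [coeff_C_mul_X_pow, if_pos rfl]
    · intro k _ hk
      rw [coeff_C_mul_X_pow, if_neg (by omega)]
    · intro h
      exact absurd (Finset.mem_range.2 hj) h
  have := congrArg (fun q => q.coeff (2 * (j + 2))) hsum
  simp only [hcoeff] at this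
  cases hs : s j <;> cases ht : t j <;> simp_all

end BlockChain

/-! ### Counting isomorphism classes. -/

/-- If rooted graphs with the required properties are pairwise non-isomorphic, then their number is
at most the order times the number of isomorphism classes. -/
theorem card_le_mul_numPlanarQuinticPerfectlyHamiltonian {ι : Type*} [Finite ι] {n : ℕ}
    (G : ι → SimpleGraph (Fin n)) (root : ι → Fin n)
    (hG : ∀ i, IsPlanarGraph (G i) ∧ IsQuintic (G i) ∧ IsPerfectlyHamiltonian (G i))
    (hinj : ∀ i j (φ : G i ≃g G j), φ (root i) = root j → i = j) :
    Nat.card ι ≤ n * numPlanarQuinticPerfectlyHamiltonian n := by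
  have hex : ∀ (i : ι) (C : Quotient (graphIsoSetoid n)), Quotient.mk _ (G i) = C →
      Nonempty (G i ≃g C.out) := by
    rintro i _ rfl
    exact Quotient.exact (Quotient.out_eq (Quotient.mk (graphIsoSetoid n) (G i))).symm
  let ψ i C h := (hex i C h).some
  let S : Set (Quotient (graphIsoSetoid n)) := {C | ∃ G : SimpleGraph (Fin n),
    Quotient.mk (graphIsoSetoid n) G = C ∧
      IsPlanarGraph G ∧ IsQuintic G ∧ IsPerfectlyHamiltonian G}
  have hS : numPlanarQuinticPerfectlyHamiltonian n = Nat.card S := rfl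
  let f : ι → Fin n × S := fun i => (ψ i _ rfl (root i), ⟨Quotient.mk _ (G i), G i, rfl, hG i⟩)
  have hf : Function.Injective f := by
    intro i j hij
    have h1 : ψ i _ rfl (root i) = ψ j _ rfl (root j) := congrArg Prod.fst hij
    have h2 : Quotient.mk (graphIsoSetoid n) (G i) = Quotient.mk _ (G j) :=
      congrArg (fun x => x.2.1) hij
    -- The chosen isomorphism to the representative is indexed by the class, so equal classes must
    -- be substituted before the root images are compared.
    have h3 : ∀ C (h : Quotient.mk (graphIsoSetoid n) (G i) = C),
        ψ i C h (root i) = ψ i _ rfl (root i) := by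
      rintro _ rfl
      rfl
    refine hinj i j ((ψ i _ h2).trans (ψ j _ rfl).symm) ?_
    change (ψ j _ rfl).symm (ψ i _ h2 (root i)) = root j
    rw [h3 _ h2, h1, RelIso.symm_apply_apply]
  calc Nat.card ι ≤ Nat.card (Fin n × S) := Nat.card_le_card_of_injective f hf
    _ = n * numPlanarQuinticPerfectlyHamiltonian n := by
      rw [Nat.card_prod, Nat.card_eq_fintype_card, Fintype.card_fin, hS]

/-- Each letter of `b` followed by its negation, then constantly `false`. -/
def doubledWord {p : ℕ} (b : Fin p → Bool) (k : ℕ) : Bool :=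
  if h : k / 2 < p then if k % 2 = 0 then b ⟨k / 2, h⟩ else !b ⟨k / 2, h⟩ else false

/-- Each letter and its negation contribute one short and one long block, 26 + 28 = 54 vertices,
whatever the letter. -/
theorem sum_size_doubledWord {p : ℕ} (b : Fin p → Bool) (r : ℕ) :
    ∑ k ∈ Finset.range (2 * p + r), (BlockChain.letter (doubledWord b k)).size =
      54 * p + 26 * r := by
  have h1 : ∀ q ≤ p, ∑ k ∈ Finset.range (2 * q), (BlockChain.letter (doubledWord b k)).size =
      54 * q := by
    intro q
    induction q with
    | zero => simp
    | succ q ih =>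
      intro hq
      rw [mul_add, mul_one, Finset.sum_range_succ, Finset.sum_range_succ, ih (by omega)]
      have e1 : 2 * q / 2 = q := by omega
      have e2 : (2 * q + 1) / 2 = q := by omega
      have e3 : (2 * q + 1) % 2 = 1 := by omega
      have hq' : q < p := hq
      cases hb : b ⟨q, hq'⟩ <;>
        simp [doubledWord, e1, e2, e3, hq', hb, BlockChain.letter, Block.size] <;> omega
  rw [Finset.sum_range_add, h1 p le_rfl]
  have h2 : ∀ k ∈ Finset.range r,
      (BlockChain.letter (doubledWord b (2 * p + k))).size = 26 := by
    intro k _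
    have : ¬ (2 * p + k) / 2 < p := by omega
    simp [doubledWord, this, BlockChain.letter, Block.size]
  rw [Finset.sum_congr rfl h2]
  simp [mul_comm]

theorem two_pow_le_mul_numPlanarQuinticPerfectlyHamiltonian (p r : ℕ) :
    2 ^ p ≤ (28 + 54 * p + 26 * r) *
      numPlanarQuinticPerfectlyHamiltonian (28 + 54 * p + 26 * r) := by
  let T : (Fin p → Bool) → BlockChain := fun b => .ofWord (doubledWord b) (2 * p + r)
  have hcard : ∀ b, Fintype.card (T b).Vertex = 28 + 54 * p + 26 * r := by
    intro b
    rw [BlockChain.card_ofWord, sum_size_doubledWord, add_assoc]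
  let e : ∀ b, (T b).Vertex ≃ Fin (28 + 54 * p + 26 * r) :=
    fun b => Fintype.equivFinOfCardEq (hcard b)
  have : Nonempty (Fin (28 + 54 * p + 26 * r)) := ⟨⟨0, by omega⟩⟩
  have key := card_le_mul_numPlanarQuinticPerfectlyHamiltonian
    (fun b => ((T b).coloured.congr (e b)).graph) (fun b => e b (T b).root)
    (fun b => ⟨(T b).isPlanarGraph_congr (e b), ColouredNeighbours.isQuintic _,
      ColouredNeighbours.isPerfectlyHamiltonian _ fun c d hcd =>
        (T b).coloured.pairGraph_congr_preconnected (e b)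
          (BlockChain.pairGraph_preconnected hcd)⟩) ?_
  · rwa [Nat.card_eq_fintype_card, Fintype.card_fun, Fintype.card_bool, Fintype.card_fin] at key
  · intro b b' φ hφ
    let i := (T b).coloured.congrIso (e b)
    let i' := (T b').coloured.congrIso (e b')
    have hroot : ((i.trans φ).trans i'.symm) (T b).root = (T b').root := by
      change (e b').symm (φ (e b (T b).root)) = _
      rw [hφ, Equiv.symm_apply_apply]
    funext j
    have hj := BlockChain.word_eq_of_iso ((i.trans φ).trans i'.symm) hroot
      (j := 2 * j) (by omega)
    have e1 : 2 * (j : ℕ) / 2 = j := by omega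
    simpa [doubledWord, e1] using hj

theorem exists_eq_of_even {n : ℕ} (hn : Even n) (h : 704 ≤ n) :
    ∃ p r, n = 28 + 54 * p + 26 * r ∧ n ≤ 54 * p + 704 := by
  obtain ⟨h2, rfl⟩ := hn
  -- Halving gives `h2 - 14 = 27 * p + 13 * r`. As 25 inverts 13 modulo 27, this picks `r ≤ 26`, and
  -- 704 = 28 + 26 * 26.
  refine ⟨(h2 - 14 - 13 * (25 * (h2 - 14) % 27)) / 27, 25 * (h2 - 14) % 27, ?_, ?_⟩ <;> omega

theorem mainTheorem5 :
    ∃ c : ℝ, 1 < c ∧ ∃ N : ℕ, ∀ n : ℕ, N ≤ n → Even n →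
      c ^ n ≤ (numPlanarQuinticPerfectlyHamiltonian n : ℝ) := by
  -- With 108 = 2 * 54, the bound `n ≤ 54 * p + 704` gives `c ^ (2 * n) ≤ 2 ^ p * c ^ 1408`. One
  -- factor `c ^ n` is spent on absorbing `n * c ^ 1408` for large `n`.
  obtain ⟨c, hc1, hc⟩ : ∃ c : ℝ, 1 < c ∧ c ^ 108 = 2 := by
    refine ⟨(2 : ℝ) ^ ((108 : ℕ) : ℝ)⁻¹, Real.one_lt_rpow (by norm_num) (by norm_num), ?_⟩
    exact Real.rpow_inv_natCast_pow (by norm_num) (by norm_num)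
  have hc0 : 0 < c := by linarith
  have hlim := tendsto_pow_const_div_const_pow_of_one_lt 1 hc1
  have hev := hlim.eventually (gt_mem_nhds (show (0 : ℝ) < (c ^ 1408)⁻¹ by positivity))
  obtain ⟨N, hN⟩ := Filter.eventually_atTop.1 hev
  refine ⟨c, hc1, max N 704, fun n hn heven => ?_⟩
  have h1 := hN n ((le_max_left _ _).trans hn)
  have hn704 : 704 ≤ n := (le_max_right _ _).trans hn
  have h2 : (n : ℝ) * c ^ 1408 ≤ c ^ n := by
    rw [pow_one, div_lt_iff₀ (by positivity), inv_mul_eq_div, lt_div_iff₀ (by positivity)] at h1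
    exact h1.le
  obtain ⟨p, r, hpr, hp⟩ := exists_eq_of_even heven hn704
  have h3 : c ^ n * c ^ n ≤ 2 ^ p * c ^ 1408 := by
    rw [← hc, ← pow_mul, ← pow_add, ← pow_add]
    exact pow_le_pow_right₀ hc1.le (by omega)
  have h4 : (2 : ℝ) ^ p ≤ n * numPlanarQuinticPerfectlyHamiltonian n := by
    have := two_pow_le_mul_numPlanarQuinticPerfectlyHamiltonian p r
    rw [← hpr] at this
    exact_mod_cast this
  have hnpos : (0 : ℝ) < n * c ^ 1408 := by
    have : (0 : ℝ) < n := by exact_mod_cast (by omega : 0 < n)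
    positivity
  refine le_of_mul_le_mul_left ?_ hnpos
  calc n * c ^ 1408 * c ^ n ≤ c ^ n * c ^ n := by gcongr
    _ ≤ 2 ^ p * c ^ 1408 := h3
    _ ≤ n * numPlanarQuinticPerfectlyHamiltonian n * c ^ 1408 := by gcongr
    _ = n * c ^ 1408 * numPlanarQuinticPerfectlyHamiltonian n := by ring
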